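/- Let $\mathbb{K}$ be a field of characteristic $0$, let $R=\mathbb{K}[x_1,\ldots,x_n]$ with $x_1<\cdots<x_n$, and use the lexicographic term order throughout. Definitions. For $P\in R\setminus\mathbb{K}$ let $\mathrm{lv}(P)=x_i$ be the greatest variable occurring in $P$, and let $\mathrm{ini}(P)$ be the coefficient of $x_i^{\deg(P,x_i)}$ in $P$. A triangular set is a finite list $C=[C_1,\ldots,C_r]$ ($r\ge 0$) of polynomials in $R\setminus\mathbb{K}$ with $\mathrm{lv}(C_1)<\cdots<\mathrm{lv}(C_r)$. Its saturated ideal is $\mathrm{sat}(C)=\{P\in R:\ \exists k\ge 0,\ PJ^k\in\langle C\rangle\}$ with $J=\prod_i\mathrm{ini}(C_i)$; thus $\mathrm{sat}(\emptyset)=\langle 0\rangle$. Also put $\mathrm{sat}([1])=\langle 1\rangle$. $C$ is regular if, for every $i$, $\mathrm{ini}(C_i)$ is neither zero nor a zero-divisor in $R/\mathrm{sat}([C_1,\ldots,C_{i-1}])$. The W-characteristic set of an ideal with reduced Gröbner basis $G$ consists of the smallest element (with respect to leading terms) of $\{P\in G:\mathrm{lv}(P)=x_i\}$ for each $i$ for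 which this set is non-empty, ordered by increasing leading variable; it is $[1]$ for the unit ideal and empty for the zero ideal. A strong regular characteristic pair (src pair) is a pair $(G,C)$ such that $G$ is a reduced Gröbner basis, $C$ is the W-characteristic set of $\langle G\rangle$, $\mathrm{sat}(C)=\langle G\rangle$, and $C$ is regular; $(\{1\},[1])$ counts as a trivial src pair. An ideal $\mathfrak{J}$ divides an ideal $\mathfrak{I}$ if $\mathfrak{I}:\mathfrak{J}\ne\mathfrak{I}$. An src divisor of $\mathfrak{I}$ is an src pair $(G,C)$ such that $\mathrm{sat}(C)$ divides $\mathfrak{I}$. Theorem. Let $\mathfrak{I}\neq\langle 1\rangle$ be an ideal of $R$. Then there is an src divisor $(G,C)$ of $\mathfrak{I}$ with $\mathfrak{I}\subseteq\mathrm{sat}(C)=\langle G\rangle$ (and $\mathfrak{I}:\mathrm{sat}(C)\neq\mathfrak{I}$). Moreover, one is constructed by the following search, which starts with the list $[\mathfrak{I}]$ of pending ideals. In each step take the first pending ideal $\mathfrak{N}$ and do the following. 1. Compute the strong regularization $(G,C)$ of $\mathfrak{N}$: replace the current ideal by the saturated ideal of its W-characteristic set as long as this changes it, and let $G$ be the reduced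 Gröbner basis and $C$ the W-characteristic set of the last ideal. 2. If $\mathrm{sat}(C)$ divides $\mathfrak{I}$, return $(G,C)$ and stop. 3. Otherwise let $C^*$ be the W-characteristic set of $\mathfrak{N}$. If $\mathrm{sat}(C^*)=\mathfrak{N}$, delete $\mathfrak{N}$ from the list. If $\mathrm{sat}(C^*)\ne\mathfrak{N}$, choose any $F\in\mathrm{sat}(C^*)\setminus\mathfrak{N}$ and any $H_1,\ldots,H_t\in R\setminus\mathfrak{N}$ such that $H_1\cdots H_t$ and $F\prod_{P\in C^*}\mathrm{ini}(P)$ have the same zeros in $\overline{\mathbb{K}}^{\,n}$, and replace $\mathfrak{N}$ by $\mathfrak{N}+\langle H_1\rangle,\ldots,\mathfrak{N}+\langle H_t\rangle$. In both cases the new list may be reordered arbitrarily. For all choices made, the search stops after finitely many steps, it never gets stuck before a pair has been returned, and the pair $(G,C)$ returned is an src divisor of $\mathfrak{I}$ with $\mathfrak{I}\subseteq\mathrm{sat}(C)$. -/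

import Mathlib

namespace SrcPairs

noncomputable section

/-- The lexicographic order on the monomials in `x_0 < x_1 < ⋯ < x_{n-1}`: exponents are compared at
the greatest variable first. -/
def lexOrder (n : ℕ) : MonomialOrder (Fin n) where
  syn := Lex ((Fin n)ᵒᵈ →₀ ℕ)
  toSyn :=
    { toEquiv := (Finsupp.domCongr (M := ℕ) (OrderDual.toDual (α := Fin n))).toEquiv.trans toLex
      map_add' := fun a b => by simp [Finsupp.equivMapDomain_eq_mapDomain, Finsupp.mapDomain_add] }
  toSyn_monotone := fun a b h => Finsupp.toLex_monotone
    (fun i => h (OrderDual.ofDual i))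

variable {K : Type*} [Field K] {n : ℕ}

/-! ### Triangular sets -/

/-- The leading variable of `P`: the greatest variable that appears in `P`, and `⊥` exactly when
`P` is a constant. -/
def lv (P : MvPolynomial (Fin n) K) : WithBot (Fin n) := P.vars.max

/-- For `P` with leading variable `x_i`, the coefficient of `x_i ^ deg(P, x_i)` when `P` is written
as a polynomial in `x_i`. (For a constant `P` it is `P` itself.) -/
def ini (P : MvPolynomial (Fin n) K) : MvPolynomial (Fin n) K :=
  match lv P with
  | ⊥ => P
  | (i : Fin n) => ∑ m ∈ P.support with m i = P.degreeOf i,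
      MvPolynomial.monomial (m.erase i) (P.coeff m)

/-- The product of the initials of the members of `T`. -/
def iniProd (T : List (MvPolynomial (Fin n) K)) : MvPolynomial (Fin n) K := (T.map ini).prod

/-- The ideal generated by the members of `T`. -/
def genIdeal (T : List (MvPolynomial (Fin n) K)) : Ideal (MvPolynomial (Fin n) K) :=
  Ideal.span {P | P ∈ T}

/-- The saturated ideal `{P : ∃ k, P * J ^ k ∈ ⟨T⟩}`, with `J` the product of the initials.
It is `⟨0⟩` for the empty list and `⟨1⟩` for `[c]` with a constant `c ≠ 0`. -/
def sat (T : List (MvPolynomial (Fin n) K)) : Ideal (MvPolynomial (Fin n) K) where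
  carrier := {P | ∃ k : ℕ, P * iniProd T ^ k ∈ genIdeal T}
  zero_mem' := ⟨0, by simp⟩
  add_mem' := by
    rintro a b ⟨k, hk⟩ ⟨l, hl⟩
    refine ⟨k + l, ?_⟩
    have h1 := Ideal.mul_mem_right (iniProd T ^ l) _ hk
    have h2 := Ideal.mul_mem_right (iniProd T ^ k) _ hl
    have e : (a + b) * iniProd T ^ (k + l) =
        a * iniProd T ^ k * iniProd T ^ l + b * iniProd T ^ l * iniProd T ^ k := by ring
    rw [e]
    exact add_mem h1 h2
  smul_mem' := by
    rintro c a ⟨k, hk⟩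
    refine ⟨k, ?_⟩
    rw [smul_eq_mul, mul_assoc]
    exact Ideal.mul_mem_left _ c hk

/-- A (nontrivial) triangular set `[T_1, …, T_r]`: nonconstant polynomials with strictly increasing
leading variables; `r = 0` is allowed. -/
def IsTriangular (T : List (MvPolynomial (Fin n) K)) : Prop :=
  (∀ P ∈ T, lv P ≠ ⊥) ∧ T.Pairwise (fun P Q => lv P < lv Q)

/-- A triangular set is regular if the initial of each member is neither zero nor a zero-divisor
modulo the saturated ideal of the members before it. -/
def IsRegularSet (T : List (MvPolynomial (Fin n) K)) : Prop :=
  IsTriangular T ∧ ∀ (i : ℕ) (hi : i < T.length),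
    Ideal.Quotient.mk (sat (T.take i)) (ini T[i]) ≠ 0 ∧
    Ideal.Quotient.mk (sat (T.take i)) (ini T[i]) ∈
      nonZeroDivisors (MvPolynomial (Fin n) K ⧸ sat (T.take i))

/-! ### Lexicographic Gröbner bases and W-characteristic sets -/

/-- `G` is a lexicographic Gröbner basis of `I`. -/
def IsLexGroebner (G : Finset (MvPolynomial (Fin n) K))
    (I : Ideal (MvPolynomial (Fin n) K)) : Prop :=
  (G : Set (MvPolynomial (Fin n) K)) ⊆ I ∧
    Ideal.span ((lexOrder n).leadingTerm '' (G : Set (MvPolynomial (Fin n) K))) =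
      Ideal.span ((lexOrder n).leadingTerm '' (I : Set (MvPolynomial (Fin n) K)))

/-- `G` is the reduced lexicographic Gröbner basis of `I`: its members are monic, and no term of a
member is divisible by the leading term of another one. -/
def IsReducedLexGroebner (G : Finset (MvPolynomial (Fin n) K))
    (I : Ideal (MvPolynomial (Fin n) K)) : Prop :=
  IsLexGroebner G I ∧ (∀ P ∈ G, (lexOrder n).Monic P) ∧
    ∀ P ∈ G, ∀ Q ∈ G, Q ≠ P → ∀ m ∈ P.support, ¬ (lexOrder n).degree Q ≤ m

/-- `C` is the W-characteristic set of `I`: for each value of the leading variable that occurs in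
the reduced lexicographic Gröbner basis `G` of `I`, `C` contains the smallest member of `G` with
that leading variable, and nothing else; it is ordered by increasing leading variables. For
`I = ⟨1⟩` it is `[1]`, for `I = ⟨0⟩` it is empty. -/
def IsWCharSet (C : List (MvPolynomial (Fin n) K))
    (I : Ideal (MvPolynomial (Fin n) K)) : Prop :=
  ∃ G : Finset (MvPolynomial (Fin n) K), IsReducedLexGroebner G I ∧
    C.Pairwise (fun P Q => lv P < lv Q) ∧
    ∀ P, P ∈ C ↔ P ∈ G ∧ ∀ Q ∈ G, lv Q = lv P →
      (lexOrder n).toSyn ((lexOrder n).degree P) ≤ (lexOrder n).toSyn ((lexOrder n).degree Q)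

/-- `(G, C)` is a characteristic pair: `G` is a reduced lexicographic Gröbner basis (of the ideal it
generates) and `C` is the W-characteristic set of `⟨G⟩`. -/
def IsCharPair (G : Finset (MvPolynomial (Fin n) K))
    (C : List (MvPolynomial (Fin n) K)) : Prop :=
  IsReducedLexGroebner G (Ideal.span (G : Set (MvPolynomial (Fin n) K))) ∧
    IsWCharSet C (Ideal.span (G : Set (MvPolynomial (Fin n) K)))

/-- `(G, C)` is a strong regular characteristic pair. The pair `({1}, [1])` counts as a trivial
one. -/
def IsSrcPair (G : Finset (MvPolynomial (Fin n) K))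
    (C : List (MvPolynomial (Fin n) K)) : Prop :=
  IsCharPair G C ∧ sat C = Ideal.span (G : Set (MvPolynomial (Fin n) K)) ∧
    (IsRegularSet C ∨ (G = {1} ∧ C = [1]))

/-- `J` divides `I` if the ideal quotient `I : J` is different from `I`. -/
def IdealDivides (J I : Ideal (MvPolynomial (Fin n) K)) : Prop :=
  I.colon (J : Set (MvPolynomial (Fin n) K)) ≠ I

/-- `(G, C)` is an src divisor of `I`. -/
def IsSrcDivisor (G : Finset (MvPolynomial (Fin n) K))
    (C : List (MvPolynomial (Fin n) K)) (I : Ideal (MvPolynomial (Fin n) K)) : Prop :=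
  IsSrcPair G C ∧ IdealDivides (sat C) I

/-! ### The construction -/

/-- `StrongReg N G C`: strong regularization of `N` ends with output `(G, C)`. The loop computes
the reduced lexicographic Gröbner basis `G` and the W-characteristic set `C` of the current ideal;
it returns `(G, C)` if `sat C` is the current ideal, and otherwise goes on with `sat C`. -/
inductive StrongReg : Ideal (MvPolynomial (Fin n) K) → Finset (MvPolynomial (Fin n) K) →
    List (MvPolynomial (Fin n) K) → Prop
  | finish {N : Ideal (MvPolynomial (Fin n) K)} {G : Finset (MvPolynomial (Fin n) K)}
      {C : List (MvPolynomial (Fin n) K)} (hG : IsReducedLexGroebner G N) (hC : IsWCharSet C N)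
      (h : sat C = N) : StrongReg N G C
  | saturate {N : Ideal (MvPolynomial (Fin n) K)} {G : Finset (MvPolynomial (Fin n) K)}
      {C D : List (MvPolynomial (Fin n) K)} (hD : IsWCharSet D N) (h : sat D ≠ N)
      (hr : StrongReg (sat D) G C) : StrongReg N G C

/-- `H_1, …, H_t` is an admissible choice of splitting polynomials for `N`, whose W-characteristic
set is `C`: no `H_i` lies in `N`, and for some `F ∈ sat C` outside `N` the product `H_1 ⋯ H_t`
vanishes at the same points over the algebraic closure as `F` times the product of the initials. -/
def IsSplitting (N : Ideal (MvPolynomial (Fin n) K)) (C H : List (MvPolynomial (Fin n) K)) : Prop :=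
  (∀ P ∈ H, P ∉ N) ∧ ∃ F ∈ sat C, F ∉ N ∧
    ∀ x : Fin n → AlgebraicClosure K,
      MvPolynomial.aeval x H.prod = 0 ↔ MvPolynomial.aeval x (F * iniProd C) = 0

/-- The states of the search: a finite list of ideals that remain to be examined, or a pair that has
been returned. -/
inductive SearchState (K : Type*) [Field K] (n : ℕ)
  | pending (A : List (Ideal (MvPolynomial (Fin n) K)))
  | returned (G : Finset (MvPolynomial (Fin n) K)) (C : List (MvPolynomial (Fin n) K))

/-- One step of the search for an src divisor of `I`. The first pending ideal `N` is taken and its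
strong regularization `(G, C)` is computed. If `sat C` divides `I`, then `(G, C)` is returned. If
not, `N` is dropped when it is the saturated ideal of its own W-characteristic set, and otherwise it
is replaced by `N + ⟨H_1⟩, …, N + ⟨H_t⟩` for some admissible `H_1, …, H_t`. The new list of pending
ideals may be put in any order, so that every order of traversal of the search tree is covered. -/
inductive SearchStep (I : Ideal (MvPolynomial (Fin n) K)) :
    SearchState K n → SearchState K n → Prop
  | hit {N : Ideal (MvPolynomial (Fin n) K)} {A : List (Ideal (MvPolynomial (Fin n) K))}
      {G : Finset (MvPolynomial (Fin n) K)} {C : List (MvPolynomial (Fin n) K)}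
      (hp : StrongReg N G C) (hd : IdealDivides (sat C) I) :
      SearchStep I (.pending (N :: A)) (.returned G C)
  | drop {N : Ideal (MvPolynomial (Fin n) K)} {A B : List (Ideal (MvPolynomial (Fin n) K))}
      {G : Finset (MvPolynomial (Fin n) K)} {C D : List (MvPolynomial (Fin n) K)}
      (hp : StrongReg N G C) (hd : ¬ IdealDivides (sat C) I)
      (hD : IsWCharSet D N) (h : sat D = N) (hB : B.Perm A) :
      SearchStep I (.pending (N :: A)) (.pending B)
  | split {N : Ideal (MvPolynomial (Fin n) K)} {A B : List (Ideal (MvPolynomial (Fin n) K))}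
      {G : Finset (MvPolynomial (Fin n) K)} {C D H : List (MvPolynomial (Fin n) K)}
      (hp : StrongReg N G C) (hd : ¬ IdealDivides (sat C) I)
      (hD : IsWCharSet D N) (h : sat D ≠ N) (hH : IsSplitting N D H)
      (hB : B.Perm (H.map (fun P => N ⊔ Ideal.span {P}) ++ A)) :
      SearchStep I (.pending (N :: A)) (.pending B)

/-- `s` occurs in some run of the search for an src divisor of `I`, which starts with `I` as the
only pending ideal. -/
def SearchReaches (I : Ideal (MvPolynomial (Fin n) K)) (s : SearchState K n) : Prop :=
  Relation.ReflTransGen (SearchStep I) (.pending [I]) s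

end

end SrcPairs

namespace SrcPairs

open MvPolynomial

/-! ### Lexicographic Gröbner bases -/

section Groebner

variable {σ K : Type*} [Field K] (m : MonomialOrder σ)

/-! The search keeps an ideal B with I : B = I such that every prime above I contains B or some
pending ideal (`SearchInvariant`). A dropped N equals the saturated ideal of its strong
regularization, so it does not divide I, and B may be replaced by B * N because non-divisors of I
are closed under products (`colon_mul_eq`). A split keeps the cover: by the Nullstellensatz the
product of the H_i lies in the radical of N, so a prime above N contains some H_i
(`IsSplitting.prod_mem_radical`). If the list became empty, B would lie in every prime above I,
hence in the radical of I; then a power of B lies in I although I : B ^ k = I, which forces I = ⟨1⟩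
(`eq_top_of_colon_eq`).

A split replaces an ideal by finitely many strictly larger ones and a drop by none, so in a
Noetherian ring the multiset of pending ideals descends in a well-founded order
(`SearchStep.cutExpand`). A splitting always exists: F together with the initials will do, since
reducedness of the Gröbner basis keeps the initials outside a proper N (`IsWCharSet.ini_notMem`).

A returned pair is strong regular because pseudo-division by a W-characteristic set leaves remainder
zero on its ideal. This gives N ⊆ sat C (`IsWCharSet.le_sat`) and, applied to initial segments of C
together with extraction of coefficients, the regularity of C at a fixed point of saturation
(`IsWCharSet.isRegularSet`). -/

lemma exists_monic_degree_eq {I : Ideal (MvPolynomial σ K)} {f : MvPolynomial σ K}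
    (hf : f ∈ I) (h0 : f ≠ 0) : ∃ g ∈ I, m.Monic g ∧ m.degree g = m.degree f := by
  have hc : m.leadingCoeff f ≠ 0 := m.leadingCoeff_ne_zero_iff.mpr h0
  have hu : (C (m.leadingCoeff f)⁻¹ : MvPolynomial σ K) ≠ 0 := by simpa using h0
  refine ⟨C (m.leadingCoeff f)⁻¹ * f, I.mul_mem_left _ hf, ?_, ?_⟩
  · rw [MonomialOrder.Monic, m.leadingCoeff_mul, m.leadingCoeff_C, inv_mul_cancel₀ hc]
  · rw [m.degree_mul hu h0, m.degree_C, zero_add]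

/-- Division with remainder by all of `I`: the remainder contains no leading monomial of `I`. -/
lemma exists_normalForm (I : Ideal (MvPolynomial σ K)) (f : MvPolynomial σ K) :
    ∃ r, f - r ∈ I ∧ ∀ c ∈ r.support, ∀ b ∈ I, b ≠ 0 → ¬ m.degree b ≤ c := by
  obtain ⟨g, r, hfr, -, hr⟩ := m.div_set (B := {b | b ∈ I ∧ m.Monic b})
    (fun b hb => by rw [hb.2.leadingCoeff_eq_one]; exact isUnit_one) f
  refine ⟨r, ?_, fun c hc b hb h0 hle => ?_⟩
  · rw [hfr, add_sub_cancel_right, Finsupp.linearCombination_apply]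
    exact Submodule.sum_mem _ fun b _ => I.mul_mem_left _ b.2.1
  · obtain ⟨b', hb', hmon, hdeg⟩ := exists_monic_degree_eq m hb h0
    exact hr c hc b' ⟨hb', hmon⟩ (hdeg ▸ hle)

end Groebner

variable {K : Type*} [Field K] {n : ℕ}

lemma span_leadingTerm_of_monic {G : Set (MvPolynomial (Fin n) K)}
    (hG : ∀ P ∈ G, (lexOrder n).Monic P) :
    (lexOrder n).leadingTerm '' G =
      (fun s => monomial s (1 : K)) '' ((lexOrder n).degree '' G) := by
  rw [Set.image_image]
  refine Set.image_congr fun P hP => ?_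
  rw [MonomialOrder.leadingTerm, (hG P hP).leadingCoeff_eq_one]

lemma isLexGroebner_iff {G : Finset (MvPolynomial (Fin n) K)}
    {I : Ideal (MvPolynomial (Fin n) K)} (hG : ∀ P ∈ G, (lexOrder n).Monic P) :
    IsLexGroebner G I ↔ (G : Set (MvPolynomial (Fin n) K)) ⊆ I ∧
      ∀ f ∈ I, f ≠ 0 → ∃ g ∈ G, (lexOrder n).degree g ≤ (lexOrder n).degree f := by
  have hspan := span_leadingTerm_of_monic (G := (G : Set (MvPolynomial (Fin n) K))) hG
  refine and_congr_right fun hsub => ⟨fun h f hf h0 => ?_, fun h => le_antisymm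
    (Ideal.span_mono (Set.image_mono hsub)) (Ideal.span_le.mpr ?_)⟩
  · have hmem : (lexOrder n).leadingTerm f ∈
        Ideal.span ((lexOrder n).leadingTerm '' (G : Set (MvPolynomial (Fin n) K))) :=
      h ▸ Ideal.subset_span ⟨f, hf, rfl⟩
    rw [hspan, mem_ideal_span_monomial_image] at hmem
    obtain ⟨_, ⟨g, hg, rfl⟩, hle⟩ := hmem ((lexOrder n).degree f) (by
      rw [(lexOrder n).support_leadingTerm' h0]; simp)
    exact ⟨g, hg, hle⟩
  · rintro _ ⟨f, hf, rfl⟩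
    rw [hspan, SetLike.mem_coe, mem_ideal_span_monomial_image]
    intro c hc
    have h0 : f ≠ 0 := by
      rintro rfl
      simp at hc
    rw [(lexOrder n).support_leadingTerm' h0, Finset.mem_singleton] at hc
    obtain ⟨g, hg, hle⟩ := h f hf h0
    exact ⟨_, ⟨g, hg, rfl⟩, hc ▸ hle⟩

lemma IsReducedLexGroebner.exists_degree_le {G : Finset (MvPolynomial (Fin n) K)}
    {I : Ideal (MvPolynomial (Fin n) K)} (h : IsReducedLexGroebner G I)
    {f : MvPolynomial (Fin n) K} (hf : f ∈ I) (h0 : f ≠ 0) :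
    ∃ g ∈ G, (lexOrder n).degree g ≤ (lexOrder n).degree f :=
  ((isLexGroebner_iff h.2.1).mp h.1).2 f hf h0

lemma IsReducedLexGroebner.ne_zero {G : Finset (MvPolynomial (Fin n) K)}
    {I : Ideal (MvPolynomial (Fin n) K)} (h : IsReducedLexGroebner G I)
    {g : MvPolynomial (Fin n) K} (hg : g ∈ G) : g ≠ 0 :=
  (h.2.1 g hg).ne_zero

/-- By Dickson's lemma there are finitely many minimal leading exponents of I. For each such a, the
monomial with exponent a minus its normal form is a member of the basis: no exponent of a normal
form is divisible by a leading exponent of I. -/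
lemma exists_isReducedLexGroebner (I : Ideal (MvPolynomial (Fin n) K)) :
    ∃ G, IsReducedLexGroebner G I := by
  classical
  set L : Set (Fin n →₀ ℕ) := {a | ∃ f ∈ I, f ≠ 0 ∧ (lexOrder n).degree f = a} with hL
  have hfin : {a | Minimal (· ∈ L) a}.Finite :=
    (setOfPred_minimal_antichain _).finite_of_partiallyWellOrderedOn
      (Set.isPWO_of_wellQuasiOrderedLE _)
  choose r hrI hr using fun a : Fin n →₀ ℕ =>
    exists_normalForm (lexOrder n) I (monomial a (1 : K))
  have hcoef : ∀ a ∈ L, (r a).coeff a = 0 := by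
    rintro a ⟨f, hf, h0, hfa⟩
    by_contra hne
    exact hr a a (mem_support_iff.mpr hne) f hf h0 hfa.le
  have hcoef1 : ∀ a ∈ L, (monomial a (1 : K) - r a).coeff a = 1 := fun a ha => by
    rw [coeff_sub, coeff_monomial, if_pos rfl, hcoef a ha, sub_zero]
  have hsupp : ∀ a, ∀ c ∈ (monomial a (1 : K) - r a).support, c = a ∨ c ∈ (r a).support := by
    intro a c hc
    by_contra! hcon
    rw [mem_support_iff, coeff_sub, coeff_monomial, if_neg (Ne.symm hcon.1),
      notMem_support_iff.mp hcon.2] at hc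
    simp at hc
  have hne : ∀ a ∈ L, monomial a (1 : K) - r a ≠ 0 := fun a ha h => by
    simpa [h] using hcoef1 a ha
  -- The leading exponent of this member of I cannot come from the normal form, so it is a.
  have hdeg : ∀ a ∈ L, (lexOrder n).degree (monomial a (1 : K) - r a) = a := by
    intro a ha
    rcases hsupp a _ ((lexOrder n).degree_mem_support (hne a ha)) with h | h
    · exact h
    · exact absurd le_rfl (hr a _ h _ (hrI a) (hne a ha))
  have hmonic : ∀ a ∈ L, (lexOrder n).Monic (monomial a (1 : K) - r a) := fun a ha => by
    rw [MonomialOrder.Monic, MonomialOrder.leadingCoeff, hdeg a ha, hcoef1 a ha]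
  have hM : ∀ P ∈ hfin.toFinset.image fun a => monomial a (1 : K) - r a,
      (lexOrder n).Monic P := by
    intro P hP
    obtain ⟨a, ha, rfl⟩ := Finset.mem_image.mp hP
    exact hmonic a (hfin.mem_toFinset.mp ha).prop
  refine ⟨hfin.toFinset.image fun a => monomial a (1 : K) - r a,
    (isLexGroebner_iff hM).mpr ⟨?_, ?_⟩, hM, ?_⟩
  · intro P hP
    obtain ⟨a, ha, rfl⟩ := Finset.mem_image.mp hP
    exact hrI a
  · intro f hf h0
    obtain ⟨a, hle, ha⟩ := exists_minimal_le_of_wellFoundedLT (· ∈ L) _ ⟨f, hf, h0, rfl⟩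
    exact ⟨_, Finset.mem_image_of_mem _ (hfin.mem_toFinset.mpr ha), (hdeg a ha.prop).trans_le hle⟩
  · intro P hP Q hQ hPQ c hc hle
    obtain ⟨a, ha, rfl⟩ := Finset.mem_image.mp hP
    obtain ⟨b, hb, rfl⟩ := Finset.mem_image.mp hQ
    have ha' : Minimal (· ∈ L) a := hfin.mem_toFinset.mp ha
    have hb' : Minimal (· ∈ L) b := hfin.mem_toFinset.mp hb
    rcases hsupp a c hc with rfl | h
    · rw [hdeg b hb'.prop] at hle
      exact hPQ (by rw [ha'.eq_of_le hb'.prop hle])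
    · exact hr a c h _ (hrI b) (hne b hb'.prop) hle

lemma IsReducedLexGroebner.subset {G G' : Finset (MvPolynomial (Fin n) K)}
    {I : Ideal (MvPolynomial (Fin n) K)} (h : IsReducedLexGroebner G I)
    (h' : IsReducedLexGroebner G' I) : G ⊆ G' := by
  intro g hg
  obtain ⟨g', hg', hle'⟩ := h'.exists_degree_le (h.1.1 hg) (h.ne_zero hg)
  obtain ⟨k, hk, hle⟩ := h.exists_degree_le (h'.1.1 hg') (h'.ne_zero hg')
  have hkg : k = g := by
    by_contra hne
    exact h.2.2 g hg k hk hne _ ((lexOrder n).degree_mem_support (h.ne_zero hg)) (hle.trans hle')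
  subst hkg
  have hdeg : (lexOrder n).degree k = (lexOrder n).degree g' := le_antisymm hle hle'
  -- The leading terms cancel, so the leading exponent of a nonzero difference would be a lower
  -- exponent of `k` or of `g'`. It is divisible by the leading exponent of another basis member,
  -- against reducedness.
  suffices k - g' = 0 by rwa [sub_eq_zero.mp this]
  by_contra hne
  have hI : k - g' ∈ I := I.sub_mem (h.1.1 hg) (h'.1.1 hg')
  have hd := (lexOrder n).degree_mem_support hne
  have hcancel : (k - g').coeff ((lexOrder n).degree k) = 0 := by
    rw [coeff_sub, (h.2.1 k hg).coeff_degree, hdeg, (h'.2.1 g' hg').coeff_degree, sub_self]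
  have hlt : ¬ (lexOrder n).degree k ≤ (lexOrder n).degree (k - g') := by
    intro hle2
    have h1 := (lexOrder n).toSyn_monotone hle2
    have h2 := (lexOrder n).degree_sub_le (f := k) (g := g')
    rw [← hdeg, sup_idem] at h2
    have h3 := (lexOrder n).toSyn.injective (le_antisymm h1 h2)
    rw [h3] at hcancel
    exact mem_support_iff.mp hd hcancel
  by_cases hk : (lexOrder n).degree (k - g') ∈ k.support
  · obtain ⟨q, hq, hqle⟩ := h.exists_degree_le hI hne
    by_cases hqk : q = k
    · exact hlt (hqk ▸ hqle)
    · exact h.2.2 k hg q hq hqk _ hk hqle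
  · have hk' : (lexOrder n).degree (k - g') ∈ g'.support := by
      rw [mem_support_iff] at hd ⊢
      rw [coeff_sub, notMem_support_iff.mp hk, zero_sub, neg_ne_zero] at hd
      exact hd
    obtain ⟨q, hq, hqle⟩ := h'.exists_degree_le hI hne
    by_cases hqk : q = g'
    · exact hlt (by rw [hdeg]; exact hqk ▸ hqle)
    · exact h'.2.2 g' hg' q hq hqk _ hk' hqle

lemma IsReducedLexGroebner.unique {G G' : Finset (MvPolynomial (Fin n) K)}
    {I : Ideal (MvPolynomial (Fin n) K)} (h : IsReducedLexGroebner G I)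
    (h' : IsReducedLexGroebner G' I) : G = G' :=
  (h.subset h').antisymm (h'.subset h)

lemma IsReducedLexGroebner.span_eq {G : Finset (MvPolynomial (Fin n) K)}
    {I : Ideal (MvPolynomial (Fin n) K)} (h : IsReducedLexGroebner G I) :
    Ideal.span (G : Set (MvPolynomial (Fin n) K)) = I := by
  refine le_antisymm (Ideal.span_le.mpr h.1.1) fun f hf => ?_
  obtain ⟨q, r, hfr, -, hr⟩ := (lexOrder n).div_set
    (B := (G : Set (MvPolynomial (Fin n) K)))
    (fun b hb => by rw [(h.2.1 b hb).leadingCoeff_eq_one]; exact isUnit_one) f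
  have hq : Finsupp.linearCombination _
      (fun (b : (G : Set (MvPolynomial (Fin n) K))) ↦ (b : MvPolynomial (Fin n) K)) q ∈
      Ideal.span (G : Set (MvPolynomial (Fin n) K)) := by
    rw [Finsupp.linearCombination_apply]
    exact Submodule.sum_mem _ fun b _ => Ideal.mul_mem_left _ _ (Ideal.subset_span b.2)
  have hrI : r ∈ I := by
    have := I.sub_mem hf (Ideal.span_le.mpr h.1.1 hq)
    rwa [hfr, add_sub_cancel_left] at this
  have hr0 : r = 0 := by
    by_contra h0
    obtain ⟨g, hg, hle⟩ := h.exists_degree_le hrI h0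
    exact hr _ ((lexOrder n).degree_mem_support h0) g hg hle
  rw [hfr, hr0, add_zero]
  exact hq

lemma exists_isWCharSet (I : Ideal (MvPolynomial (Fin n) K)) : ∃ C, IsWCharSet C I := by
  classical
  obtain ⟨G, hG⟩ := exists_isReducedLexGroebner I
  set M : Finset (MvPolynomial (Fin n) K) := G.filter fun P => ∀ Q ∈ G, lv Q = lv P →
      (lexOrder n).toSyn ((lexOrder n).degree P) ≤ (lexOrder n).toSyn ((lexOrder n).degree Q)
    with hM
  -- Two minimal members with the same leading variable share their leading exponent, which a
  -- reduced basis forbids for distinct members. Hence each fibre of `lv` listed by `f` has at most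
  -- one element.
  have hinj : ∀ P ∈ M, ∀ Q ∈ M, lv P = lv Q → P = Q := by
    intro P hP Q hQ hlv
    rw [hM, Finset.mem_filter] at hP hQ
    have hd := (lexOrder n).toSyn.injective
      (le_antisymm (hP.2 Q hQ.1 hlv.symm) (hQ.2 P hP.1 hlv))
    by_contra hne
    exact hG.2.2 P hP.1 Q hQ.1 (Ne.symm hne) _
      ((lexOrder n).degree_mem_support (hG.ne_zero hP.1)) hd.ge
  let f : WithBot (Fin n) → List (MvPolynomial (Fin n) K) :=
    fun i => (M.filter fun P => lv P = i).toList
  refine ⟨(((M.image lv).sort (· ≤ ·))).flatMap f, G, hG, ?_, ?_⟩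
  · rw [List.pairwise_flatMap]
    refine ⟨fun i _ => ?_, ?_⟩
    · refine List.Pairwise.imp_of_mem (R := (· ≠ ·)) ?_ (Finset.nodup_toList _)
      intro P Q hP hQ hne
      simp only [f, Finset.mem_toList, Finset.mem_filter] at hP hQ
      exact absurd (hinj P hP.1 Q hQ.1 (hP.2.trans hQ.2.symm)) hne
    · refine List.Pairwise.imp ?_ (Finset.sortedLT_sort _).pairwise
      intro i j hij P hP Q hQ
      simp only [f, Finset.mem_toList, Finset.mem_filter] at hP hQ
      rw [hP.2, hQ.2]
      exact hij
  · intro P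
    have : P ∈ ((M.image lv).sort (· ≤ ·)).flatMap f ↔ P ∈ M := by
      simp only [f, List.mem_flatMap, Finset.mem_sort, Finset.mem_image, Finset.mem_toList,
        Finset.mem_filter]
      exact ⟨fun ⟨_, _, h, _⟩ => h, fun h => ⟨lv P, ⟨P, h, rfl⟩, h, rfl⟩⟩
    rw [this, hM, Finset.mem_filter]

lemma IsWCharSet.unique {C D : List (MvPolynomial (Fin n) K)}
    {I : Ideal (MvPolynomial (Fin n) K)} (hC : IsWCharSet C I) (hD : IsWCharSet D I) :
    C = D := by
  obtain ⟨G, hG, hCs, hCm⟩ := hC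
  obtain ⟨G', hG', hDs, hDm⟩ := hD
  obtain rfl := hG.unique hG'
  have : Std.Irrefl fun P Q : MvPolynomial (Fin n) K => lv P < lv Q := ⟨fun _ => lt_irrefl _⟩
  have : Std.Asymm fun P Q : MvPolynomial (Fin n) K => lv P < lv Q := ⟨fun _ _ => lt_asymm⟩
  exact hCs.eq_of_mem_iff hDs fun {P} => (hCm P).trans (hDm P).symm

/-! ### Initials and pseudo-division -/

lemma monomial_mem_restrictSupport_of_mem {S : Set (Fin n →₀ ℕ)} {m : Fin n →₀ ℕ} {c : K}
    (h : m ∈ S) : monomial m c ∈ restrictSupport K S := by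
  rw [monomial_mem_restrictSupport]
  exact Or.inl h

lemma lexOrder_apply_le {a b : Fin n →₀ ℕ} (h : (lexOrder n).toSyn a ≤ (lexOrder n).toSyn b)
    {i : Fin n} (hi : ∀ j, i < j → a j = b j) : a i ≤ b i := by
  by_contra! hlt
  refine absurd h (not_le_of_gt ?_)
  exact Finsupp.Lex.lt_iff.mpr ⟨OrderDual.toDual i, fun j hj => (hi (OrderDual.ofDual j) hj).symm,
    hlt⟩

lemma le_of_mem_vars {P : MvPolynomial (Fin n) K} {i j : Fin n} (h : lv P = i)
    (hj : j ∈ P.vars) : j ≤ i := by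
  have := Finset.le_max hj
  rw [lv] at h
  rw [h] at this
  exact_mod_cast this

lemma apply_eq_zero_of_lv_lt {P : MvPolynomial (Fin n) K} {i j : Fin n} (h : lv P = i)
    (hij : i < j) {m : Fin n →₀ ℕ} (hm : m ∈ P.support) : m j = 0 := by
  by_contra hne
  exact absurd (le_of_mem_vars h ((mem_vars_iff_mem_support _).mpr ⟨m, hm, Finsupp.mem_support_iff.mpr hne⟩))
    (not_le_of_gt hij)

lemma ne_zero_of_lv_eq {P : MvPolynomial (Fin n) K} {i : Fin n} (h : lv P = i) : P ≠ 0 := by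
  rintro rfl
  simp [lv] at h

lemma eq_C_of_lv_eq_bot {P : MvPolynomial (Fin n) K} (h : lv P = ⊥) : ∃ c, P = C c := by
  have hv : P.vars = ∅ := Finset.max_eq_bot.mp h
  exact ⟨_, (vars_eq_empty_iff_eq_C.mp hv)⟩

lemma degreeOf_pos_of_lv_eq {P : MvPolynomial (Fin n) K} {i : Fin n} (h : lv P = i) :
    0 < P.degreeOf i := by
  obtain ⟨m, hm, hmi⟩ := (mem_vars_iff_mem_support _).mp (Finset.mem_of_max h)
  exact (Nat.pos_of_ne_zero (Finsupp.mem_support_iff.mp hmi)).trans_le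
    (monomial_le_degreeOf i hm)

/-- No variable above x_i occurs in P, so the lexicographic comparison is decided first by the
exponent of x_i. -/
lemma degree_apply_of_lv_eq {P : MvPolynomial (Fin n) K} {i : Fin n} (h : lv P = i) :
    (lexOrder n).degree P i = P.degreeOf i := by
  have hd := (lexOrder n).degree_mem_support (ne_zero_of_lv_eq h)
  refine le_antisymm (monomial_le_degreeOf i hd) ?_
  rw [degreeOf_le_iff]
  intro m hm
  refine lexOrder_apply_le ((lexOrder n).le_degree hm) fun j hij => ?_
  rw [apply_eq_zero_of_lv_lt h hij hm, apply_eq_zero_of_lv_lt h hij hd]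

lemma ini_of_lv_eq {P : MvPolynomial (Fin n) K} {i : Fin n} (h : lv P = i) :
    ini P = ∑ m ∈ P.support with m i = P.degreeOf i, monomial (m.erase i) (P.coeff m) := by
  unfold ini
  split
  · rename_i h'
    rw [h] at h'
    cases h'
  · rename_i j h'
    rw [h] at h'
    cases h'
    rfl

lemma ini_mem_restrictSupport {P : MvPolynomial (Fin n) K} {i : Fin n} (h : lv P = i) :
    ini P ∈ restrictSupport K {m | ∀ j, i ≤ j → m j = 0} := by
  rw [ini_of_lv_eq h]
  refine Submodule.sum_mem _ fun m hm => monomial_mem_restrictSupport_of_mem (?_)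
  intro j hij
  rcases hij.eq_or_lt with rfl | hlt
  · simp
  · rw [Finsupp.erase_ne hlt.ne',
      apply_eq_zero_of_lv_lt h hlt (Finset.mem_filter.mp hm).1]

lemma ini_mul_X_pow {P : MvPolynomial (Fin n) K} {i : Fin n} (h : lv P = i) :
    ini P * X i ^ P.degreeOf i =
      ∑ m ∈ P.support with m i = P.degreeOf i, monomial m (P.coeff m) := by
  rw [ini_of_lv_eq h, Finset.sum_mul]
  refine Finset.sum_congr rfl fun m hm => ?_
  rw [X_pow_eq_monomial, monomial_mul, mul_one, ← (Finset.mem_filter.mp hm).2,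
    Finsupp.erase_add_single]

lemma sub_ini_mul_mem {P : MvPolynomial (Fin n) K} {i : Fin n} (h : lv P = i) :
    P - ini P * X i ^ P.degreeOf i ∈
      restrictSupport K {m | m i < P.degreeOf i ∧ ∀ j, i < j → m j = 0} := by
  have hP : P = (∑ m ∈ P.support with m i = P.degreeOf i, monomial m (P.coeff m)) +
      ∑ m ∈ P.support with ¬ m i = P.degreeOf i, monomial m (P.coeff m) := by
    rw [Finset.sum_filter_add_sum_filter_not]
    exact P.as_sum
  rw [ini_mul_X_pow h]
  rw [← eq_sub_iff_add_eq'.mpr hP.symm]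
  refine Submodule.sum_mem _ fun m hm => monomial_mem_restrictSupport_of_mem (?_)
  rw [Finset.mem_filter] at hm
  exact ⟨lt_of_le_of_ne (monomial_le_degreeOf i hm.1) hm.2,
    fun j hij => apply_eq_zero_of_lv_lt h hij hm.1⟩

/-- Every exponent of the initial is an exponent of `P` with the leading variable removed. -/
lemma exists_erase_of_mem_support_ini {P : MvPolynomial (Fin n) K} {i : Fin n} (h : lv P = i)
    {a : Fin n →₀ ℕ} (ha : a ∈ (ini P).support) : ∃ m ∈ P.support, a = m.erase i := by
  classical
  rw [ini_of_lv_eq h] at ha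
  obtain ⟨m, hm, ham⟩ := Finset.mem_biUnion.mp (support_sum ha)
  exact ⟨m, (Finset.mem_filter.mp hm).1, Finset.mem_singleton.mp (support_monomial_subset ham)⟩

lemma ini_ne_zero {P : MvPolynomial (Fin n) K} {i : Fin n} (h : lv P = i) : ini P ≠ 0 := by
  intro h0
  have hmem := sub_ini_mul_mem h
  rw [h0, zero_mul, sub_zero, mem_restrictSupport_iff] at hmem
  have := (hmem ((lexOrder n).degree_mem_support (ne_zero_of_lv_eq h))).1
  rw [degree_apply_of_lv_eq h] at this
  exact lt_irrefl _ this

lemma mul_mem_restrictSupport {S T U : Set (Fin n →₀ ℕ)} (hU : ∀ a ∈ S, ∀ b ∈ T, a + b ∈ U)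
    {P Q : MvPolynomial (Fin n) K} (hP : P ∈ restrictSupport K S)
    (hQ : Q ∈ restrictSupport K T) : P * Q ∈ restrictSupport K U :=
  restrictSupport_mono K (Set.add_subset_iff.mpr hU)
    (restrictSupport_add (R := K) S T ▸ Submodule.mul_mem_mul hP hQ)

/-- Pseudo-division by a single polynomial, relative to a condition `S` on the exponents of the
variables above the leading one. -/
lemma exists_ini_pow_mul_sub_mem {Q : MvPolynomial (Fin n) K} {i : Fin n} (h : lv Q = i)
    {S : Set (Fin n →₀ ℕ)} (hS : ∀ m m', (∀ j, i < j → m j = m' j) → m ∈ S → m' ∈ S)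
    (b : ℕ) : ∀ P ∈ restrictSupport K (S ∩ {m | m i < b}),
      ∃ k : ℕ, ∃ R ∈ restrictSupport K (S ∩ {m | m i < Q.degreeOf i}),
        ini Q ^ k * P - R ∈ Ideal.span {Q} := by
  -- The initial involves only variables below x_i, whereas `S` depends only on exponents above i.
  have hini : ∀ R ∈ restrictSupport K (S ∩ {m | m i < Q.degreeOf i}),
      ini Q * R ∈ restrictSupport K (S ∩ {m | m i < Q.degreeOf i}) := fun R hR => by
    refine mul_mem_restrictSupport ?_ (ini_mem_restrictSupport h) hR
    refine fun a ha b hb => ⟨hS b _ (fun j hj => ?_) hb.1, ?_⟩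
    · simp [ha j hj.le]
    · simpa [ha i le_rfl] using hb.2
  have hinipow : ∀ k : ℕ, ∀ R ∈ restrictSupport K (S ∩ {m | m i < Q.degreeOf i}),
      ini Q ^ k * R ∈ restrictSupport K (S ∩ {m | m i < Q.degreeOf i}) := by
    intro k
    induction k with
    | zero => intro R hR; simpa using hR
    | succ k ih => intro R hR; rw [pow_succ', mul_assoc]; exact hini _ (ih R hR)
  induction b with
  | zero =>
    intro P hP
    have : P = 0 := by
      have : (P.support : Set (Fin n →₀ ℕ)) = ∅ :=
        Set.eq_empty_of_subset_empty (by simpa [mem_restrictSupport_iff] using hP)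
      simpa using this
    exact ⟨0, 0, Submodule.zero_mem _, by simp [this]⟩
  | succ b ih =>
    intro P hP
    rw [restrictSupport_eq_span] at hP
    induction hP using Submodule.span_induction with
    | mem x hx =>
      obtain ⟨m, ⟨hmS, hmb⟩, rfl⟩ := hx
      rw [Set.mem_ofPred_eq] at hmb
      by_cases hd : m i < Q.degreeOf i
      · exact ⟨0, monomial m 1, monomial_mem_restrictSupport_of_mem (⟨hmS, hd⟩), by simp⟩
      have hsplit : monomial m (1 : K) =
          monomial (m - Finsupp.single i (Q.degreeOf i)) 1 * X i ^ Q.degreeOf i := by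
        rw [X_pow_eq_monomial, monomial_mul, mul_one, tsub_add_cancel_of_le]
        rw [Finsupp.single_le_iff]
        omega
      -- Modulo Q, the leading part ini Q * x_i ^ d equals minus the tail of Q. Multiplying once by
      -- the initial therefore trades the monomial for terms of smaller degree in x_i.
      obtain ⟨k, R, hR, hk⟩ := ih (-(monomial (m - Finsupp.single i (Q.degreeOf i)) (1 : K) *
          (Q - ini Q * X i ^ Q.degreeOf i))) (by
        refine Submodule.neg_mem _ (mul_mem_restrictSupport (S := {m - Finsupp.single i _})
          ?_ (monomial_mem_restrictSupport_of_mem (rfl)) (sub_ini_mul_mem h))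
        rintro _ rfl a ⟨ha, ha'⟩
        refine ⟨hS m _ (fun j hj => ?_) hmS, ?_⟩
        · simp [ha' j hj, Finsupp.single_eq_of_ne hj.ne']
        · simp only [Set.mem_ofPred_eq, Finsupp.add_apply, Finsupp.tsub_apply,
            Finsupp.single_eq_same]
          omega)
      refine ⟨k + 1, R, hR, ?_⟩
      beta_reduce
      rw [hsplit]
      convert Ideal.add_mem _ (Ideal.mul_mem_left _ (ini Q ^ k *
        monomial (m - Finsupp.single i (Q.degreeOf i)) 1) (Ideal.mem_span_singleton_self Q)) hk
        using 1
      ring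
    | zero => exact ⟨0, 0, Submodule.zero_mem _, by simp⟩
    | add x y _ _ hx hy =>
      obtain ⟨k, R, hR, hk⟩ := hx
      obtain ⟨l, R', hR', hl⟩ := hy
      refine ⟨k + l, ini Q ^ l * R + ini Q ^ k * R',
        Submodule.add_mem _ (hinipow l R hR) (hinipow k R' hR'), ?_⟩
      convert Ideal.add_mem _ (Ideal.mul_mem_left _ (ini Q ^ l) hk)
        (Ideal.mul_mem_left _ (ini Q ^ k) hl) using 1
      ring
    | smul c x _ hx =>
      obtain ⟨k, R, hR, hk⟩ := hx
      refine ⟨k, c • R, Submodule.smul_mem _ c hR, ?_⟩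
      rw [mul_smul_comm, ← smul_sub, smul_eq_C_mul]
      exact Ideal.mul_mem_left _ _ hk

/-- The exponents that are reduced with respect to every member of `T`. -/
def reducedExponents (T : List (MvPolynomial (Fin n) K)) : Set (Fin n →₀ ℕ) :=
  {m | ∀ Q ∈ T, ∀ i : Fin n, lv Q = i → m i < Q.degreeOf i}

lemma genIdeal_mono {T U : List (MvPolynomial (Fin n) K)} (h : T ⊆ U) :
    genIdeal T ≤ genIdeal U :=
  Ideal.span_mono fun _ hP => h hP

lemma mem_genIdeal {T : List (MvPolynomial (Fin n) K)} {P : MvPolynomial (Fin n) K}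
    (h : P ∈ T) : P ∈ genIdeal T :=
  Ideal.subset_span h

/-- Pseudo-division by a triangular set. -/
lemma exists_mul_sub_mem_genIdeal {T : List (MvPolynomial (Fin n) K)} (hT : IsTriangular T)
    {S : Set (Fin n →₀ ℕ)} (hS : ∀ Q ∈ T, ∀ i : Fin n, lv Q = i →
      ∀ m m', (∀ j, i < j → m j = m' j) → m ∈ S → m' ∈ S)
    {P : MvPolynomial (Fin n) K} (hP : P ∈ restrictSupport K S) :
    ∃ u, (∃ k : ℕ, u ∣ iniProd T ^ k) ∧ ∃ R ∈ restrictSupport K (S ∩ reducedExponents T),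
      u * P - R ∈ genIdeal T := by
  induction T with
  | nil =>
    refine ⟨1, ⟨0, one_dvd _⟩, P, restrictSupport_mono K ?_ hP, by simp⟩
    exact fun m hm => ⟨hm, by simp [reducedExponents]⟩
  | cons Q T ih =>
    obtain ⟨hlv, hsort⟩ := hT
    rw [List.pairwise_cons] at hsort
    -- Division starts with the greater leading variables. The later division by Q leaves the
    -- conditions on exponents above its leading variable intact, so the remainder stays reduced
    -- with respect to `T`.
    obtain ⟨u, ⟨k, hu⟩, R, hR, huR⟩ := ih ⟨fun P hP => hlv P (by simp [hP]), hsort.2⟩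
      fun P hP => hS P (by simp [hP])
    obtain ⟨i, hi⟩ := WithBot.ne_bot_iff_exists.mp (hlv Q (by simp))
    obtain ⟨l, R', hR', hl⟩ := exists_ini_pow_mul_sub_mem hi.symm
      (S := S ∩ reducedExponents T) (fun m m' hm hmS => ⟨hS Q (by simp) i hi.symm m m' hm hmS.1,
        fun P hP j hj => by
          have hij : i < j := by
            have := hsort.1 P hP
            rw [hj, ← hi] at this
            exact_mod_cast this
          rw [← hm j hij]
          exact hmS.2 P hP j hj⟩) (R.degreeOf i + 1) R
      fun m hm => ⟨hR hm, Nat.lt_succ_of_le (monomial_le_degreeOf i hm)⟩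
    refine ⟨ini Q ^ l * u, ⟨l + k, ?_⟩, R', restrictSupport_mono K ?_ hR', ?_⟩
    · simp only [iniProd, List.map_cons, List.prod_cons] at hu ⊢
      rw [mul_pow, pow_add, pow_add]
      exact mul_dvd_mul (dvd_mul_right _ _) (hu.trans (dvd_mul_left _ _))
    · rintro m ⟨⟨hmS, hmT⟩, hmQ⟩
      refine ⟨hmS, fun P hP j hj => ?_⟩
      rcases List.mem_cons.mp hP with rfl | hP
      · rw [hj] at hi
        cases hi
        exact hmQ
      · exact hmT P hP j hj
    · have h1 : ini Q ^ l * R - R' ∈ genIdeal (Q :: T) :=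
        Ideal.span_mono (by simp) hl
      have h2 := genIdeal_mono (List.subset_cons_self Q T) huR
      convert Ideal.add_mem _ (Ideal.mul_mem_left _ (ini Q ^ l) h2) h1 using 1
      ring

/-! ### Saturated ideals -/

lemma genIdeal_le_sat (T : List (MvPolynomial (Fin n) K)) : genIdeal T ≤ sat T :=
  fun _ hP => ⟨0, by simpa using hP⟩

lemma mem_sat_of_dvd_mul_mem {T : List (MvPolynomial (Fin n) K)} {P u : MvPolynomial (Fin n) K}
    {k : ℕ} (hu : u ∣ iniProd T ^ k) (h : u * P ∈ genIdeal T) : P ∈ sat T := by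
  obtain ⟨v, hv⟩ := hu
  refine ⟨k, ?_⟩
  rw [hv]
  convert Ideal.mul_mem_left _ v h using 1
  ring

lemma mem_sat_of_mul_iniProd_mem {T : List (MvPolynomial (Fin n) K)}
    {P : MvPolynomial (Fin n) K} (h : P * iniProd T ∈ sat T) : P ∈ sat T := by
  obtain ⟨k, hk⟩ := h
  exact ⟨k + 1, by rwa [pow_succ', ← mul_assoc]⟩

lemma ini_dvd_iniProd {T : List (MvPolynomial (Fin n) K)} {P : MvPolynomial (Fin n) K}
    (h : P ∈ T) : ini P ∣ iniProd T :=
  List.dvd_prod (List.mem_map_of_mem h)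

lemma mem_sat_of_mul_ini_mem {T : List (MvPolynomial (Fin n) K)}
    {P Q : MvPolynomial (Fin n) K} (hQ : Q ∈ T) (h : P * ini Q ∈ sat T) : P ∈ sat T := by
  obtain ⟨v, hv⟩ := ini_dvd_iniProd hQ
  refine mem_sat_of_mul_iniProd_mem ?_
  rw [hv, ← mul_assoc]
  exact Ideal.mul_mem_right _ _ h

lemma sat_mono {T U : List (MvPolynomial (Fin n) K)} (h : T.Sublist U) : sat T ≤ sat U := by
  rintro P ⟨k, hk⟩
  obtain ⟨v, hv⟩ : iniProd T ∣ iniProd U := (h.map ini).prod_dvd_prod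
  refine ⟨k, ?_⟩
  rw [hv, mul_pow, ← mul_assoc]
  exact Ideal.mul_mem_right _ _ (genIdeal_mono h.subset hk)

/-! ### Basic properties of W-characteristic sets -/

lemma eq_top_of_lv_eq_bot {I : Ideal (MvPolynomial (Fin n) K)} {P : MvPolynomial (Fin n) K}
    (hP : P ∈ I) (h0 : P ≠ 0) (h : lv P = ⊥) : I = ⊤ := by
  obtain ⟨c, rfl⟩ := eq_C_of_lv_eq_bot h
  have hc : c ≠ 0 := by
    rintro rfl
    simp at h0
  exact Ideal.eq_top_of_isUnit_mem _ hP (hc.isUnit.map C)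

lemma IsWCharSet.genIdeal_le {C : List (MvPolynomial (Fin n) K)}
    {I : Ideal (MvPolynomial (Fin n) K)} (h : IsWCharSet C I) : genIdeal C ≤ I := by
  obtain ⟨G, hG, -, hC⟩ := h
  exact Ideal.span_le.mpr fun P hP => hG.1.1 ((hC P).mp hP).1

lemma IsWCharSet.ne_zero {C : List (MvPolynomial (Fin n) K)}
    {I : Ideal (MvPolynomial (Fin n) K)} (h : IsWCharSet C I)
    {P : MvPolynomial (Fin n) K} (hP : P ∈ C) : P ≠ 0 := by
  obtain ⟨G, hG, -, hC⟩ := h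
  exact hG.ne_zero ((hC P).mp hP).1

lemma IsWCharSet.isTriangular {C : List (MvPolynomial (Fin n) K)}
    {I : Ideal (MvPolynomial (Fin n) K)} (h : IsWCharSet C I) (hI : I ≠ ⊤) :
    IsTriangular C := by
  refine ⟨fun P hP hlv => hI (eq_top_of_lv_eq_bot (h.genIdeal_le (mem_genIdeal hP))
    (h.ne_zero hP) hlv), ?_⟩
  obtain ⟨G, hG, hs, hC⟩ := h
  exact hs

/-- The basis member g whose leading exponent divides that of R need not lie in C. It links R to the
member Q of C in its own class: Q is lexicographically at most g, and g is componentwise at most R.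
-/
lemma IsWCharSet.exists_lv_eq {C : List (MvPolynomial (Fin n) K)}
    {I : Ideal (MvPolynomial (Fin n) K)} (h : IsWCharSet C I)
    {R : MvPolynomial (Fin n) K} (hR : R ∈ I) (h0 : R ≠ 0) :
    ∃ Q ∈ C, ∃ g ∈ I, g ≠ 0 ∧ lv g = lv Q ∧
      (lexOrder n).toSyn ((lexOrder n).degree Q) ≤ (lexOrder n).toSyn ((lexOrder n).degree g) ∧
      (lexOrder n).degree g ≤ (lexOrder n).degree R := by
  classical
  obtain ⟨G, hG, -, hC⟩ := h
  obtain ⟨g, hg, hle⟩ := hG.exists_degree_le hR h0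
  obtain ⟨Q, hQ, hmin⟩ := (G.filter fun Q => lv Q = lv g).exists_min_image
    (fun Q => (lexOrder n).toSyn ((lexOrder n).degree Q)) ⟨g, by simp [hg]⟩
  rw [Finset.mem_filter] at hQ
  refine ⟨Q, (hC Q).mpr ⟨hQ.1, fun P hP hPQ => hmin P ?_⟩, g, hG.1.1 hg, hG.ne_zero hg,
    hQ.2.symm, hmin g (by simp [hg]), hle⟩
  exact Finset.mem_filter.mpr ⟨hP, hPQ.trans hQ.2⟩

/-- No nonzero member of `I` is reduced with respect to the W-characteristic set of `I`. -/
lemma IsWCharSet.exists_degreeOf_le {C : List (MvPolynomial (Fin n) K)}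
    {I : Ideal (MvPolynomial (Fin n) K)} (h : IsWCharSet C I) (hI : I ≠ ⊤)
    {R : MvPolynomial (Fin n) K} (hR : R ∈ I) (h0 : R ≠ 0) :
    ∃ Q ∈ C, ∃ i : Fin n, lv Q = i ∧ Q.degreeOf i ≤ (lexOrder n).degree R i := by
  obtain ⟨Q, hQ, g, hg, hg0, hlv, hdeg, hle⟩ := h.exists_lv_eq hR h0
  obtain ⟨i, hi⟩ := WithBot.ne_bot_iff_exists.mp ((h.isTriangular hI).1 Q hQ)
  refine ⟨Q, hQ, i, hi.symm, ?_⟩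
  rw [← hi] at hlv
  rw [← degree_apply_of_lv_eq hi.symm]
  refine (lexOrder_apply_le hdeg fun j hj => ?_).trans (hle i)
  rw [apply_eq_zero_of_lv_lt hi.symm hj ((lexOrder n).degree_mem_support (h.ne_zero hQ)),
    apply_eq_zero_of_lv_lt hlv hj ((lexOrder n).degree_mem_support hg0)]

/-- A member of `I` lies in `sat T` if no nonzero member of `I` is reduced with respect to `T`. -/
lemma mem_sat_of_reduced_eq_zero {T : List (MvPolynomial (Fin n) K)}
    {I : Ideal (MvPolynomial (Fin n) K)} (hT : IsTriangular T) (hTI : genIdeal T ≤ I)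
    {S : Set (Fin n →₀ ℕ)} (hS : ∀ Q ∈ T, ∀ i : Fin n, lv Q = i →
      ∀ m m', (∀ j, i < j → m j = m' j) → m ∈ S → m' ∈ S)
    (hred : ∀ R ∈ I, R ∈ restrictSupport K (S ∩ reducedExponents T) → R = 0)
    {P : MvPolynomial (Fin n) K} (hP : P ∈ I) (hPS : P ∈ restrictSupport K S) : P ∈ sat T := by
  obtain ⟨u, ⟨k, hu⟩, R, hR, huR⟩ := exists_mul_sub_mem_genIdeal hT hS hPS
  have hRI : R ∈ I := by
    have := I.sub_mem (I.mul_mem_left u hP) (hTI huR)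
    rwa [sub_sub_cancel] at this
  rw [hred R hRI hR, sub_zero] at huR
  exact mem_sat_of_dvd_mul_mem hu huR

/-- The pseudo-remainder of a member of a proper I is again in I and reduced with respect to C,
hence zero. For the unit ideal, C contains a nonzero constant. -/
lemma IsWCharSet.le_sat {C : List (MvPolynomial (Fin n) K)}
    {I : Ideal (MvPolynomial (Fin n) K)} (h : IsWCharSet C I) : I ≤ sat C := by
  by_cases hI : I = ⊤
  · obtain ⟨Q, hQ, g, -, -, hlv, -, hle⟩ := h.exists_lv_eq (R := 1) (by simp [hI]) one_ne_zero
    have hg : lv Q = ⊥ := by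
      rw [← hlv]
      rw [(lexOrder n).degree_one, nonpos_iff_eq_zero, (lexOrder n).degree_eq_zero_iff] at hle
      rw [hle, lv, vars_C]
      rfl
    have htop := eq_top_of_lv_eq_bot (mem_genIdeal hQ) (h.ne_zero hQ) hg
    exact le_top.trans (htop ▸ genIdeal_le_sat C)
  · intro P hP
    refine mem_sat_of_reduced_eq_zero (h.isTriangular hI) h.genIdeal_le (S := Set.univ)
      (fun _ _ _ _ _ _ _ _ => trivial) (fun R hR hRS => ?_) hP (by simp)
    by_contra h0
    obtain ⟨Q, hQ, i, hi, hle⟩ := h.exists_degreeOf_le hI hR h0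
    exact absurd ((hRS ((lexOrder n).degree_mem_support h0)).2 Q hQ i hi) (not_lt_of_ge hle)

/-- Otherwise the leading exponent of some basis member g would divide an exponent of P with x_i
removed. Then g ≠ P, since P has positive leading degree in x_i, and P would not be reduced against
g. -/
lemma IsWCharSet.ini_notMem {C : List (MvPolynomial (Fin n) K)}
    {I : Ideal (MvPolynomial (Fin n) K)} (h : IsWCharSet C I) (hI : I ≠ ⊤)
    {P : MvPolynomial (Fin n) K} (hP : P ∈ C) : ini P ∉ I := by
  intro hmem
  obtain ⟨i, hi⟩ := WithBot.ne_bot_iff_exists.mp ((h.isTriangular hI).1 P hP)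
  have h0 := ini_ne_zero hi.symm
  obtain ⟨m, hm, hdeg⟩ := exists_erase_of_mem_support_ini hi.symm
    ((lexOrder n).degree_mem_support h0)
  obtain ⟨G, hG, -, hC⟩ := h
  obtain ⟨g, hg, hle⟩ := hG.exists_degree_le hmem h0
  rw [hdeg] at hle
  by_cases hgP : g = P
  · have := hle i
    rw [hgP, degree_apply_of_lv_eq hi.symm, Finsupp.erase_same] at this
    exact absurd (degreeOf_pos_of_lv_eq hi.symm) (not_lt_of_ge this)
  · refine hG.2.2 P ((hC P).mp hP).1 g hg hgP m hm (hle.trans fun j => ?_)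
    by_cases hj : j = i
    · simp [hj]
    · rw [Finsupp.erase_ne hj]

/-! ### Coefficients with respect to the variables from a given one upwards -/

/-- The exponents in which only variables below `l` occur. -/
def exponentsBelow (l : Fin n) : Set (Fin n →₀ ℕ) := {m | ∀ j, l ≤ j → m j = 0}

/-- The coefficient of the monomial `e` in the variables `≥ l`, as a polynomial in the variables
below `l`. -/
noncomputable def coeffAbove (l : Fin n) (e : Fin n →₀ ℕ) :
    MvPolynomial (Fin n) K →ₗ[K] MvPolynomial (Fin n) K :=
  (basisMonomials (Fin n) K).constr K fun m =>
    if m.filter (l ≤ ·) = e then monomial (m.filter fun j => ¬ l ≤ j) 1 else 0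

lemma coeffAbove_monomial (l : Fin n) (e m : Fin n →₀ ℕ) (c : K) :
    coeffAbove l e (monomial m c) =
      if m.filter (l ≤ ·) = e then monomial (m.filter fun j => ¬ l ≤ j) c else 0 := by
  have h1 : monomial m c = c • (basisMonomials (Fin n) K m) := by
    rw [coe_basisMonomials, smul_monomial, smul_eq_mul, mul_one]
  rw [h1, map_smul, coeffAbove, Module.Basis.constr_basis]
  split_ifs
  · rw [smul_monomial, smul_eq_mul, mul_one]
  · rw [smul_zero]

lemma coeffAbove_mem (l : Fin n) (e : Fin n →₀ ℕ) (P : MvPolynomial (Fin n) K) :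
    coeffAbove l e P ∈ restrictSupport K (exponentsBelow l) := by
  induction P using MvPolynomial.induction_on' with
  | monomial m c =>
    rw [coeffAbove_monomial]
    split_ifs
    · refine monomial_mem_restrictSupport_of_mem fun j hj => ?_
      rw [Finsupp.filter_apply_neg]
      simpa using hj
    · exact Submodule.zero_mem _
  | add P Q hP hQ =>
    rw [map_add]
    exact Submodule.add_mem _ hP hQ

lemma coeffAbove_mul (l : Fin n) (e : Fin n →₀ ℕ) (P : MvPolynomial (Fin n) K)
    {Q : MvPolynomial (Fin n) K} (hQ : Q ∈ restrictSupport K (exponentsBelow l)) :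
    coeffAbove l e (P * Q) = coeffAbove l e P * Q := by
  rw [restrictSupport_eq_span] at hQ
  induction hQ using Submodule.span_induction with
  | mem x hx =>
    obtain ⟨b, hb, rfl⟩ := hx
    induction P using MvPolynomial.induction_on' with
    | monomial m c =>
      have h1 : b.filter (l ≤ ·) = 0 := by
        ext j
        by_cases hj : l ≤ j
        · rw [Finsupp.filter_apply_pos _ _ hj, hb j hj, Finsupp.zero_apply]
        · rw [Finsupp.filter_apply_neg _ _ hj, Finsupp.zero_apply]
      have h2 : (b.filter fun j => ¬ l ≤ j) = b := by
        have := Finsupp.filter_add_filter_not b (l ≤ ·)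
        rwa [h1, zero_add] at this
      simp only [monomial_mul, coeffAbove_monomial, Finsupp.filter_add, h1, h2, add_zero, mul_one]
      split_ifs
      · rw [monomial_mul, mul_one]
      · rw [zero_mul]
    | add P Q hP hQ => rw [add_mul, map_add, hP, hQ, map_add, add_mul]
  | zero => simp
  | add x y _ _ hx hy => rw [mul_add, map_add, hx, hy, mul_add]
  | smul c x _ hx => rw [mul_smul_comm, map_smul, hx, mul_smul_comm]

lemma sum_coeffAbove_mul_monomial (l : Fin n) (P : MvPolynomial (Fin n) K) :
    ∑ e ∈ P.support.image (fun m => m.filter (l ≤ ·)),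
      coeffAbove l e P * monomial e (1 : K) = P := by
  conv_rhs => rw [P.as_sum]
  have : ∀ e, coeffAbove l e P * monomial e (1 : K) =
      ∑ m ∈ P.support, if m.filter (l ≤ ·) = e then monomial m (P.coeff m) else 0 := by
    intro e
    conv_lhs => rw [P.as_sum]
    rw [map_sum, Finset.sum_mul]
    refine Finset.sum_congr rfl fun m _ => ?_
    rw [coeffAbove_monomial]
    split_ifs with h
    · rw [monomial_mul, mul_one, ← h, add_comm, Finsupp.filter_add_filter_not]
    · rw [zero_mul]
  simp_rw [this]
  rw [Finset.sum_comm]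
  refine Finset.sum_congr rfl fun m hm => ?_
  rw [Finset.sum_ite_eq, if_pos (Finset.mem_image_of_mem _ hm)]

lemma coeffAbove_mem_genIdeal (l : Fin n) (e : Fin n →₀ ℕ) {T : List (MvPolynomial (Fin n) K)}
    (hT : ∀ Q ∈ T, Q ∈ restrictSupport K (exponentsBelow l)) {P : MvPolynomial (Fin n) K}
    (hP : P ∈ genIdeal T) : coeffAbove l e P ∈ genIdeal T := by
  -- `coeffAbove` is linear only over polynomials below l, so the induction over the ideal needs all
  -- multiples at once.
  suffices ∀ c, coeffAbove l e (c * P) ∈ genIdeal T by simpa using this 1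
  induction hP using Submodule.span_induction with
  | mem x hx =>
    intro c
    rw [coeffAbove_mul l e c (hT x hx)]
    exact Ideal.mul_mem_left _ _ (mem_genIdeal hx)
  | zero => simp
  | add x y _ _ hx hy =>
    intro c
    rw [mul_add, map_add]
    exact Ideal.add_mem _ (hx c) (hy c)
  | smul a x _ hx =>
    intro c
    rw [smul_eq_mul, ← mul_assoc]
    exact hx _

lemma mul_mem_exponentsBelow {l : Fin n} {P Q : MvPolynomial (Fin n) K}
    (hP : P ∈ restrictSupport K (exponentsBelow l))
    (hQ : Q ∈ restrictSupport K (exponentsBelow l)) :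
    P * Q ∈ restrictSupport K (exponentsBelow l) := by
  refine mul_mem_restrictSupport ?_ hP hQ
  intro a ha b hb j hj
  rw [Finsupp.add_apply, ha j hj, hb j hj]

lemma one_mem_exponentsBelow (l : Fin n) :
    (1 : MvPolynomial (Fin n) K) ∈ restrictSupport K (exponentsBelow l) :=
  monomial_mem_restrictSupport_of_mem (m := 0) fun _ _ => rfl

lemma pow_mem_exponentsBelow {l : Fin n} {P : MvPolynomial (Fin n) K}
    (hP : P ∈ restrictSupport K (exponentsBelow l)) (k : ℕ) :
    P ^ k ∈ restrictSupport K (exponentsBelow l) := by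
  induction k with
  | zero => simpa using one_mem_exponentsBelow l
  | succ k ih => rw [pow_succ]; exact mul_mem_exponentsBelow ih hP

lemma mem_exponentsBelow_of_lv_lt {l : Fin n} {Q : MvPolynomial (Fin n) K}
    (h : lv Q < l) : Q ∈ restrictSupport K (exponentsBelow l) := by
  intro m hm j hj
  by_contra hne
  have := Finset.le_max ((mem_vars_iff_mem_support j).mpr
    ⟨m, hm, Finsupp.mem_support_iff.mpr hne⟩)
  have h2 : ((j : Fin n) : WithBot (Fin n)) < l := this.trans_lt h
  exact absurd hj (not_le_of_gt (by exact_mod_cast h2))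

lemma iniProd_mem_exponentsBelow {l : Fin n} {T : List (MvPolynomial (Fin n) K)}
    (hlv : ∀ Q ∈ T, lv Q ≠ ⊥) (hT : ∀ Q ∈ T, lv Q < l) :
    iniProd T ∈ restrictSupport K (exponentsBelow l) := by
  induction T with
  | nil => simpa [iniProd] using one_mem_exponentsBelow l
  | cons Q T ih =>
    obtain ⟨i, hi⟩ := WithBot.ne_bot_iff_exists.mp (hlv Q (by simp))
    have hil : i < l := by
      have := hT Q (by simp)
      rw [← hi] at this
      exact_mod_cast this
    rw [iniProd, List.map_cons, List.prod_cons]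
    refine mul_mem_exponentsBelow (restrictSupport_mono K ?_ (ini_mem_restrictSupport hi.symm))
      (ih (fun P hP => hlv P (by simp [hP])) fun P hP => hT P (by simp [hP]))
    exact fun m hm j hj => hm j (hil.le.trans hj)

/-! ### Regularity of W-characteristic sets -/

lemma mem_take_of_lv_lt {C : List (MvPolynomial (Fin n) K)}
    (hC : C.Pairwise fun P Q => lv P < lv Q) {k : ℕ} (hk : k < C.length)
    {Q : MvPolynomial (Fin n) K} (hQ : Q ∈ C) (h : lv Q < lv C[k]) : Q ∈ C.take k := by
  obtain ⟨j, hj, rfl⟩ := List.getElem_of_mem hQ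
  have hjk : j < k := by
    by_contra! hle
    rcases hle.eq_or_lt with rfl | hlt
    · exact lt_irrefl _ h
    · exact lt_asymm h (List.pairwise_iff_getElem.mp hC k j hk hj hlt)
  exact List.mem_take_iff_getElem.mpr ⟨j, by omega, rfl⟩

lemma lv_lt_of_mem_take {C : List (MvPolynomial (Fin n) K)}
    (hC : C.Pairwise fun P Q => lv P < lv Q) {k : ℕ} (hk : k < C.length)
    {Q : MvPolynomial (Fin n) K} (hQ : Q ∈ C.take k) : lv Q < lv C[k] := by
  obtain ⟨j, hj, rfl⟩ := List.mem_take_iff_getElem.mp hQ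
  exact List.pairwise_iff_getElem.mp hC j k (by omega) hk (by omega)

/-- If a proper ideal is the saturated ideal of its W-characteristic set, then this set is
regular. -/
lemma IsWCharSet.isRegularSet {C : List (MvPolynomial (Fin n) K)}
    (h : IsWCharSet C (sat C)) (hI : sat C ≠ ⊤) : IsRegularSet C := by
  have htri := h.isTriangular hI
  refine ⟨htri, fun k hk => ?_⟩
  obtain ⟨l, hl⟩ := WithBot.ne_bot_iff_exists.mp (htri.1 C[k] (List.getElem_mem hk))
  have hlt : ∀ Q ∈ C.take k, lv Q < l := fun Q hQ => hl ▸ lv_lt_of_mem_take htri.2 hk hQ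
  have hsub : sat (C.take k) ≤ sat C := sat_mono (List.take_sublist k C)
  have htriT : IsTriangular (C.take k) :=
    ⟨fun Q hQ => htri.1 Q (List.mem_of_mem_take hQ), htri.2.sublist (List.take_sublist k C)⟩
  -- Pseudo-division by the initial segment introduces no variable from x_l upwards. Its remainder
  -- is therefore reduced with respect to all of C, hence zero.
  have hlow : ∀ P ∈ sat C, P ∈ restrictSupport K (exponentsBelow l) → P ∈ sat (C.take k) := by
    intro P hP hPl
    refine mem_sat_of_reduced_eq_zero htriT ((genIdeal_le_sat _).trans hsub)
      (S := exponentsBelow l) (fun Q hQ i hi m m' hm hmS j hj => ?_) (fun R hR hRS => ?_) hP hPl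
    · have : i < l := by
        have := hlt Q hQ
        rw [hi] at this
        exact_mod_cast this
      rw [← hm j (this.trans_le hj)]
      exact hmS j hj
    · by_contra h0
      obtain ⟨Q, hQ, i, hi, hle⟩ := h.exists_degreeOf_le hI hR h0
      have hmem : (lexOrder n).degree R ∈ exponentsBelow l ∩ reducedExponents (C.take k) :=
        hRS ((lexOrder n).degree_mem_support h0)
      have hil : i < l := by
        by_contra! hli
        rw [hmem.1 i hli] at hle
        exact absurd (degreeOf_pos_of_lv_eq hi) (not_lt_of_ge hle)
      have hQT : Q ∈ C.take k := mem_take_of_lv_lt htri.2 hk hQ (by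
        rw [hi, ← hl]
        exact_mod_cast hil)
      exact absurd (hmem.2 Q hQT i hi) (not_lt_of_ge hle)
  have hini : ini C[k] ∈ restrictSupport K (exponentsBelow l) := ini_mem_restrictSupport hl.symm
  refine ⟨fun h0 => hI ?_, mem_nonZeroDivisors_iff_right.mpr fun x hx => ?_⟩
  · rw [Ideal.Quotient.eq_zero_iff_mem] at h0
    rw [Ideal.eq_top_iff_one]
    exact mem_sat_of_mul_ini_mem (List.getElem_mem hk) (by simpa using hsub h0)
  · obtain ⟨P, rfl⟩ := Ideal.Quotient.mk_surjective x
    rw [← map_mul, Ideal.Quotient.eq_zero_iff_mem] at hx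
    obtain ⟨s, hs⟩ := hx
    rw [Ideal.Quotient.eq_zero_iff_mem, ← sum_coeffAbove_mul_monomial l P]
    -- Each coefficient of P times the initial lies in the saturation of the initial segment. The
    -- initial can be cancelled in `sat C`, where it is a factor of the saturating product, and
    -- `hlow` then leads back to the segment.
    refine Ideal.sum_mem _ fun e _ => Ideal.mul_mem_right _ _ ?_
    refine hlow _ (mem_sat_of_mul_ini_mem (List.getElem_mem hk) (hsub ⟨s, ?_⟩))
      (coeffAbove_mem l e P)
    have hJ := pow_mem_exponentsBelow (iniProd_mem_exponentsBelow htriT.1 hlt) s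
    rw [← coeffAbove_mul l e P hini, ← coeffAbove_mul l e _ hJ]
    exact coeffAbove_mem_genIdeal l e (fun Q hQ => mem_exponentsBelow_of_lv_lt (hlt Q hQ)) hs

/-! ### Strong regularization -/

lemma StrongReg.output {N : Ideal (MvPolynomial (Fin n) K)}
    {G : Finset (MvPolynomial (Fin n) K)} {C : List (MvPolynomial (Fin n) K)}
    (h : StrongReg N G C) :
    IsReducedLexGroebner G (sat C) ∧ IsWCharSet C (sat C) ∧ N ≤ sat C := by
  induction h with
  | finish hG hC h => exact ⟨h.symm ▸ hG, h.symm ▸ hC, h.ge⟩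
  | saturate hD _ _ ih => exact ⟨ih.1, ih.2.1, hD.le_sat.trans ih.2.2⟩

lemma exists_strongReg (N : Ideal (MvPolynomial (Fin n) K)) : ∃ G C, StrongReg N G C := by
  induction N using WellFoundedGT.induction with
  | ind N ih =>
    obtain ⟨D, hD⟩ := exists_isWCharSet N
    by_cases h : sat D = N
    · obtain ⟨G, hG⟩ := exists_isReducedLexGroebner N
      exact ⟨G, D, .finish hG hD h⟩
    · obtain ⟨G, C, hr⟩ := ih (sat D) (lt_of_le_of_ne hD.le_sat (Ne.symm h))
      exact ⟨G, C, .saturate hD h hr⟩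

/-- Uniqueness of the W-characteristic set excludes a saturation step at a fixed point. -/
lemma StrongReg.sat_eq {N : Ideal (MvPolynomial (Fin n) K)}
    {G : Finset (MvPolynomial (Fin n) K)} {C D : List (MvPolynomial (Fin n) K)}
    (h : StrongReg N G C) (hD : IsWCharSet D N) (hsat : sat D = N) : sat C = N := by
  cases h with
  | finish hG hC h => exact h
  | saturate hD' h' _ => exact absurd (hD.unique hD' ▸ hsat) h'

lemma StrongReg.isSrcPair {N : Ideal (MvPolynomial (Fin n) K)}
    {G : Finset (MvPolynomial (Fin n) K)} {C : List (MvPolynomial (Fin n) K)}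
    (h : StrongReg N G C) (hC : sat C ≠ ⊤) : IsSrcPair G C := by
  obtain ⟨hG, hCW, -⟩ := h.output
  have hspan := hG.span_eq
  exact ⟨⟨hspan.symm ▸ hG, hspan.symm ▸ hCW⟩, hspan.symm, Or.inl (hCW.isRegularSet hC)⟩

/-! ### Ideal quotients -/

/-- Since I : ⟨1⟩ = I, the trivial pair is never returned. -/
lemma ne_top_of_idealDivides {I J : Ideal (MvPolynomial (Fin n) K)} (h : IdealDivides J I) :
    J ≠ ⊤ := by
  rintro rfl
  exact h (by simp)

lemma colon_mul_eq {R : Type*} [CommRing R] {I A B : Ideal R}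
    (hA : I.colon (A : Set R) = I) (hB : I.colon (B : Set R) = I) :
    I.colon ((A * B : Ideal R) : Set R) = I := by
  refine le_antisymm (fun x hx => ?_) Ideal.le_colon
  rw [← hA, Submodule.mem_colon]
  intro a ha
  rw [← hB, Submodule.mem_colon]
  intro b hb
  rw [smul_assoc]
  exact Submodule.mem_colon.mp hx _ (Ideal.mul_mem_mul ha hb)

lemma colon_top_eq {R : Type*} [CommRing R] (I : Ideal R) :
    I.colon ((⊤ : Ideal R) : Set R) = I :=
  Submodule.colon_univ

/-- An ideal with `I : A = I` is not contained in the radical of `I`, unless `I = ⟨1⟩`. -/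
lemma eq_top_of_colon_eq {R : Type*} [CommRing R] [IsNoetherianRing R] {I A : Ideal R}
    (hA : I.colon (A : Set R) = I) (h : A ≤ I.radical) : I = ⊤ := by
  obtain ⟨k, hk⟩ := Ideal.exists_pow_le_of_le_radical_of_fg h (IsNoetherian.noetherian A)
  have hpow : ∀ k : ℕ, I.colon ((A ^ k : Ideal R) : Set R) = I := by
    intro k
    induction k with
    | zero => rw [pow_zero, Ideal.one_eq_top, colon_top_eq]
    | succ k ih => rw [pow_succ]; exact colon_mul_eq ih hA
  rw [← hpow k]
  exact (Submodule.colon_eq_top_iff_subset _).mpr hk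

/-! ### Splitting -/

/-- Some F * J ^ k lies in ⟨C⟩ ⊆ N, so F * J vanishes at every zero of N, and so does the product of
the H_i. The Nullstellensatz turns this into radical membership. -/
lemma IsSplitting.prod_mem_radical {N : Ideal (MvPolynomial (Fin n) K)}
    {C H : List (MvPolynomial (Fin n) K)} (h : IsSplitting N C H) (hC : IsWCharSet C N) :
    H.prod ∈ N.radical := by
  obtain ⟨-, F, ⟨k, hk⟩, -, hzero⟩ := h
  rw [← vanishingIdeal_zeroLocus_eq_radical (K := AlgebraicClosure K) N,
    mem_vanishingIdeal_iff]
  intro x hx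
  rw [hzero x, map_mul, mul_eq_zero]
  have := hx _ (hC.genIdeal_le hk)
  rw [map_mul, map_pow, mul_eq_zero] at this
  exact this.imp_right fun h => eq_zero_of_pow_eq_zero h

lemma exists_isSplitting {N : Ideal (MvPolynomial (Fin n) K)}
    {C : List (MvPolynomial (Fin n) K)} (hC : IsWCharSet C N) (h : sat C ≠ N) :
    ∃ H, IsSplitting N C H := by
  have hN : N ≠ ⊤ := fun htop => h (le_antisymm (htop ▸ le_top) hC.le_sat)
  obtain ⟨F, hF, hFN⟩ := SetLike.exists_of_lt (lt_of_le_of_ne hC.le_sat (Ne.symm h))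
  refine ⟨F :: C.map ini, fun P hP => ?_, F, hF, hFN, fun x => ?_⟩
  · rcases List.mem_cons.mp hP with rfl | hP
    · exact hFN
    · obtain ⟨Q, hQ, rfl⟩ := List.mem_map.mp hP
      exact hC.ini_notMem hN hQ
  · rw [List.prod_cons, iniProd]

/-! ### The search -/

/-- The invariant of the search: the pending ideals contain `I` and, together with an ideal that
does not divide `I`, they cover the primes above `I`; a returned pair is as required. -/
def SearchInvariant (I : Ideal (MvPolynomial (Fin n) K)) : SearchState K n → Prop
  | .pending A => (∀ N ∈ A, I ≤ N) ∧
      ∃ B : Ideal (MvPolynomial (Fin n) K), I.colon (B : Set (MvPolynomial (Fin n) K)) = I ∧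
        ∀ p : Ideal (MvPolynomial (Fin n) K), p.IsPrime → I ≤ p → B ≤ p ∨ ∃ N ∈ A, N ≤ p
  | .returned G C => IsSrcDivisor G C I ∧ I ≤ sat C

lemma searchInvariant_init (I : Ideal (MvPolynomial (Fin n) K)) :
    SearchInvariant I (.pending [I]) :=
  ⟨by simp, ⊤, colon_top_eq I, fun p _ hp => Or.inr ⟨I, by simp, hp⟩⟩

lemma SearchInvariant.step {I : Ideal (MvPolynomial (Fin n) K)} {s t : SearchState K n}
    (hs : SearchInvariant I s) (h : SearchStep I s t) : SearchInvariant I t := by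
  cases h with
  | hit hp hd =>
    exact ⟨⟨hp.isSrcPair (ne_top_of_idealDivides hd), hd⟩,
      (hs.1 _ (by simp)).trans hp.output.2.2⟩
  | @drop N A B' G C D hp hd hD h hB =>
    obtain ⟨hI, B, hBI, hcov⟩ := hs
    have hN : I.colon (N : Set (MvPolynomial (Fin n) K)) = I := by
      rw [← hp.sat_eq hD h]
      exact not_not.mp hd
    -- The dropped ideal is absorbed into B: a prime containing either factor contains `B * N`.
    refine ⟨fun M hM => hI M (by simp [hB.mem_iff.mp hM]), B * N, colon_mul_eq hBI hN,
      fun p hpp hIp => ?_⟩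
    rcases hcov p hpp hIp with h1 | ⟨M, hM, hMp⟩
    · exact Or.inl (Ideal.mul_le_left.trans h1)
    · rcases List.mem_cons.mp hM with rfl | hM
      · exact Or.inl (Ideal.mul_le_right.trans hMp)
      · exact Or.inr ⟨M, hB.mem_iff.mpr hM, hMp⟩
  | @split N A B' G C D H hp hd hD h hH hB =>
    obtain ⟨hI, B, hBI, hcov⟩ := hs
    refine ⟨fun M hM => ?_, B, hBI, fun p hpp hIp => ?_⟩
    · rcases List.mem_append.mp (hB.mem_iff.mp hM) with hM | hM
      · obtain ⟨P, -, rfl⟩ := List.mem_map.mp hM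
        exact (hI N (by simp)).trans le_sup_left
      · exact hI M (by simp [hM])
    · refine (hcov p hpp hIp).imp_right fun ⟨M, hM, hMp⟩ => ?_
      rcases List.mem_cons.mp hM with rfl | hM
      · have hprod : H.prod ∈ p := hpp.radical_le_iff.mpr hMp (hH.prod_mem_radical hD)
        obtain ⟨P, hP, hPp⟩ : ∃ P ∈ H, P ∈ p := by
          by_contra! hcon
          exact (list_prod_mem (S := p.primeCompl) hcon) hprod
        refine ⟨M ⊔ Ideal.span {P}, hB.mem_iff.mpr ?_, sup_le hMp ?_⟩
        · exact List.mem_append_left _ (List.mem_map.mpr ⟨P, hP, rfl⟩)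
        · rwa [Ideal.span_singleton_le_iff_mem]
      · exact ⟨M, hB.mem_iff.mpr (List.mem_append_right _ hM), hMp⟩

lemma SearchReaches.invariant {I : Ideal (MvPolynomial (Fin n) K)} {s : SearchState K n}
    (h : SearchReaches I s) : SearchInvariant I s := by
  induction h with
  | refl => exact searchInvariant_init I
  | tail _ hst ih => exact ih.step hst

lemma exists_searchStep {I : Ideal (MvPolynomial (Fin n) K)} (hI : I ≠ ⊤)
    {A : List (Ideal (MvPolynomial (Fin n) K))} (h : SearchInvariant I (.pending A)) :
    ∃ s, SearchStep I (.pending A) s := by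
  cases A with
  | nil =>
    obtain ⟨-, B, hB, hcov⟩ := h
    refine absurd (eq_top_of_colon_eq hB ?_) hI
    rw [Ideal.radical_eq_sInf]
    exact le_sInf fun p hp => (hcov p hp.2 hp.1).resolve_right (by simp)
  | cons N A =>
    obtain ⟨G, C, hp⟩ := exists_strongReg N
    by_cases hd : IdealDivides (sat C) I
    · exact ⟨_, .hit hp hd⟩
    obtain ⟨D, hD⟩ := exists_isWCharSet N
    by_cases hsat : sat D = N
    · exact ⟨_, .drop hp hd hD hsat (List.Perm.refl _)⟩
    · obtain ⟨H, hH⟩ := exists_isSplitting hD hsat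
      exact ⟨_, .split hp hd hD hsat hH (List.Perm.refl _)⟩

/-- Reordering is invisible in the multiset. In a split each N + ⟨H_i⟩ is strictly larger than N
because H_i ∉ N; a drop replaces N by the empty multiset. -/
lemma SearchStep.cutExpand {I : Ideal (MvPolynomial (Fin n) K)}
    {A B : List (Ideal (MvPolynomial (Fin n) K))}
    (h : SearchStep I (.pending A) (.pending B)) :
    Relation.CutExpand (· > ·) (B : Multiset (Ideal (MvPolynomial (Fin n) K))) A := by
  cases h with
  | @drop N A _ G C D hp hd hD h hB =>
    refine ⟨0, N, by simp, ?_⟩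
    rw [Multiset.coe_eq_coe.mpr hB, add_zero, add_comm, Multiset.singleton_add,
      Multiset.cons_coe]
  | @split N A _ G C D H hp hd hD h hH hB =>
    refine ⟨(H.map fun P => N ⊔ Ideal.span {P} : List _), N, fun M hM => ?_, ?_⟩
    · obtain ⟨P, hP, rfl⟩ := List.mem_map.mp (Multiset.mem_coe.mp hM)
      refine lt_of_le_of_ne le_sup_left fun heq => hH.1 P hP ?_
      rw [heq]
      exact Ideal.mem_sup_right (Ideal.mem_span_singleton_self P)
    · rw [Multiset.coe_eq_coe.mpr hB, ← Multiset.coe_add, ← Multiset.cons_coe,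
        ← Multiset.singleton_add]
      abel

lemma wellFounded_cutExpand_gt :
    WellFounded (Relation.CutExpand (α := Ideal (MvPolynomial (Fin n) K)) (· > ·)) :=
  WellFounded.cutExpand wellFounded_gt

lemma not_exists_infinite_run (I : Ideal (MvPolynomial (Fin n) K)) :
    ¬ ∃ f : ℕ → SearchState K n, ∀ k, SearchStep I (f k) (f (k + 1)) := by
  rintro ⟨f, hf⟩
  -- A returned state has no successor, so an infinite run has only pending states.
  have hpend : ∀ k, ∃ A, f k = .pending A := by
    intro k
    have := hf k
    cases hfk : f k with
    | pending A => exact ⟨A, rfl⟩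
    | returned G C =>
      rw [hfk] at this
      cases this
  choose g hg using hpend
  refine (wellFounded_iff_isEmpty_descending_chain.mp
    (wellFounded_cutExpand_gt (K := K) (n := n))).false ⟨fun k => (g k : Multiset _), fun k => ?_⟩
  have := hf k
  rw [hg k, hg (k + 1)] at this
  exact this.cutExpand

lemma exists_returned {I : Ideal (MvPolynomial (Fin n) K)} (hI : I ≠ ⊤)
    {A : List (Ideal (MvPolynomial (Fin n) K))} (hA : SearchInvariant I (.pending A)) :
    ∃ G C, IsSrcDivisor G C I ∧ I ≤ sat C := by
  obtain ⟨M, hM⟩ : ∃ M : Multiset (Ideal (MvPolynomial (Fin n) K)), (A : Multiset _) = M :=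
    ⟨_, rfl⟩
  induction M using wellFounded_cutExpand_gt.induction generalizing A with
  | _ M ih =>
    obtain ⟨s, hs⟩ := exists_searchStep hI hA
    have hinv := hA.step hs
    cases s with
    | pending B => exact ih B (hM ▸ hs.cutExpand) hinv rfl
    | returned G C => exact ⟨G, C, hinv⟩

end SrcPairs

/-- Every proper ideal `I` of `K[x_1, …, x_n]`, `char K = 0`, has an src divisor `(G, C)` with
`I ⊆ sat C`, and one is constructed by the search: no run of the search is infinite, and every run
that cannot be continued has returned such a pair. -/
theorem theorem4p3 (K : Type*) [Field K] [CharZero K] (n : ℕ)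
    (I : Ideal (MvPolynomial (Fin n) K)) (hI : I ≠ ⊤) :
    (∃ (G : Finset (MvPolynomial (Fin n) K)) (C : List (MvPolynomial (Fin n) K)),
      SrcPairs.IsSrcDivisor G C I ∧ I ≤ SrcPairs.sat C) ∧
    (¬ ∃ f : ℕ → SrcPairs.SearchState K n, f 0 = .pending [I] ∧
      ∀ k, SrcPairs.SearchStep I (f k) (f (k + 1))) ∧
    (∀ s : SrcPairs.SearchState K n, SrcPairs.SearchReaches I s →
      (∃ s', SrcPairs.SearchStep I s s') ∨
      ∃ (G : Finset (MvPolynomial (Fin n) K)) (C : List (MvPolynomial (Fin n) K)),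
        s = .returned G C ∧ SrcPairs.IsSrcDivisor G C I ∧ I ≤ SrcPairs.sat C) := by
  refine ⟨SrcPairs.exists_returned hI (SrcPairs.searchInvariant_init I), ?_, fun s hs => ?_⟩
  · rintro ⟨f, -, hf⟩
    exact SrcPairs.not_exists_infinite_run I ⟨f, hf⟩
  · cases s with
    | pending A => exact Or.inl (SrcPairs.exists_searchStep hI hs.invariant)
    | returned G C => exact Or.inr ⟨G, C, rfl, hs.invariant⟩
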